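/- \textbf{Setting.} For $n\ge 1$ let $I_n=I(3n,n^4+1,U,1)$ be the capacitated facility location (CFL) instance with a set $F$ of $N=3n$ facilities, each of capacity $U$, and a set $C$ of $m=n^4+1$ clients of unit demand, where $(n^4+1)-nU=2^{-n^2}$. A feasible mixed integer solution is a pair $(y,x)$ with $y\in\{0,1\}^F$, $0\le x_{ij}\le y_i$, $\sum_i x_{ij}=1$ for all $j\in C$ and $\sum_j x_{ij}\le U y_i$ for all $i\in F$; $P$ is the convex hull of these solutions. Admissible objective functions are $w=(f,c)$ with $f\in\mathbb{R}_{\ge0}^{F}$, $c\in\mathbb{R}_{\ge0}^{F\times C}$ and $c_{ij}\le c_{i'j}+c_{i'j'}+c_{ij'}$; the objective is to minimize $w^T(y,x)=\sum_i f_iy_i+\sum_{i,j}c_{ij}x_{ij}$, with optimum $\mathrm{Opt}_w$ over the feasible solutions. The mixed product space has a coordinate $z_{\mathcal E}$ for each nonempty $\mathcal E\subseteq F$ and a coordinate $z_{\mathcal E x_{ij}}$ for each $\mathcal E\subseteq F$, $i\in F$, $j\in C$; the mixed product section $f$ has $f_{\mathcal E}(y,x)=\prod_{i\in\mathcal E}y_i$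 and $f_{\mathcal E x_{ij}}(y,x)=\big(\prod_{i'\in\mathcal E}y_{i'}\big)x_{ij}$. Let $\hat D$ be the convex hull of the vectors $f(y,x)$ over all feasible $(y,x)$. A vector $z$ of the product space is $\rho$-gap inducing if there is an admissible $w=(f,c)$ with $\sum_i f_iz_{\{i\}}+\sum_{i,j}c_{ij}z_{\varnothing x_{ij}}<\rho^{-1}\,\mathrm{Opt}_w$. A set $s$ of vectors in the unit cube outside $\hat D$ is conflicting if $\operatorname{conv}(s)\cap\hat D\ne\varnothing$. For a set $V$ of product vectors, $\mathcal H(V)$ is the hypergraph with vertex set $V$ whose hyperedges are the conflicting subsets of $V$; its chromatic number is the least number of colours for which some colouring of $V$ leaves no hyperedge monochromatic. For disjoint $k,l\subset F$ with $|k|=|l|=n$ let $\mathcal D_{k,l}$ be the following random $(y,x)$. With probability $1-\frac{20}{n^2(1+1/n)}$ exactly the facilities in $F\setminus l$ are open and those in $k$ share the demand of every client evenly. Otherwise a subset $q$ of $F\setminus k$ with $q\cap l\ne\varnothing$ is chosen uniformly and exactly the facilities in $k\cup q$ are open; each facility in $q\cap l$ takes $\frac{m n^{-3}}{10/n^2}$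 units of demand, in expectation the same amount from every client, and the rest of the demand is distributed equally to the facilities in $k$. Let $z_{k,l}$ be the vector of the expectations under $\mathcal D_{k,l}$ of the products $\prod_{i\in\mathcal E}y_i$ and $\big(\prod_{i'\in\mathcal E}y_{i'}\big)x_{ij}$, and for fixed $k$ let $\mathcal C_I=\{z_{k,l} : l\subset F\setminus k,\ |l|=n\}$. A $\rho$-approximate extended formulation of $P$ is a system of linear inequalities $Q$ in $(y,x)$ and finitely many auxiliary variables $u$ whose projection to $(y,x)$ contains $P$ and which satisfies $\min_Q w^T(y,x)\ge\rho^{-1}\min_P w^T(y,x)$ for all admissible $w$. Its size is its number of inequalities. It has a mixed-linear section if there are functions $g^{y}$, affine in $x$ for each fixed $y\in\{0,1\}^F$, such that $(y,x,g^{y}(x))$ satisfies $Q$ for every feasible $(y,x)$. \textbf{Theorem.} There are constants $c_1,c_2,c,c_3>0$ and $n_0$ such that for all $n\ge n_0$: (1) for every $k\subset F$ with $|k|=n$, the core $\mathcal C_I$ consists of vectors of the unit cube outside $\hat D$, each of which is $c_1n$-gap inducing; $|\mathcal C_I|=\binom{2n}{n}$; any two distinct members of $\mathcal C_I$ are conflicting,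 so that $\mathcal H(\mathcal C_I)$ is a clique; and $\chi(\mathcal H(\mathcal C_I))=\binom{2n}{n}\ge 2^{c_2n}$; (2) every $cN$-approximate extended formulation of the CFL polytope $P$ of $I_n$ with a mixed-linear section has size at least $2^{c_3N}$. -/

import Mathlib

namespace CFL

/-- The data of an instance of capacitated facility location that determines its feasible
solutions: capacities of the facilities `F` and demands of the clients `C`. -/
structure CFLInstance (F C : Type) where
  capacity : F → ℝ
  demand : C → ℝ

/-- The space of the classic variables `(y, x)`: `y i` says to what extent facility `i` is open,
`x i j` is the fraction of the demand of client `j` that is assigned to facility `i`. -/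
abbrev ClassicSpace (F C : Type) : Type := (F → ℝ) × (F → C → ℝ)

section Problem

variable {F C : Type} [Fintype F] [Fintype C]

/-- The feasible mixed integer solutions: facilities are opened integrally, clients are assigned
(possibly fractionally) to open facilities, and capacities are respected. -/
def CFLInstance.feasible (I : CFLInstance F C) : Set (ClassicSpace F C) :=
  {s | (∀ i, s.1 i = 0 ∨ s.1 i = 1) ∧
    (∀ i j, 0 ≤ s.2 i j ∧ s.2 i j ≤ s.1 i) ∧
    (∀ j, ∑ i, s.2 i j = 1) ∧
    (∀ i, ∑ j, I.demand j * s.2 i j ≤ I.capacity i * s.1 i)}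

/-- The CFL polytope: the convex hull of the feasible mixed integer solutions. -/
def CFLInstance.polytope (I : CFLInstance F C) : Set (ClassicSpace F C) :=
  convexHull ℝ I.feasible

/-- The admissible objective functions: pairs `(f, c)` of nonnegative opening costs and
nonnegative connection costs that satisfy the triangle inequality. -/
def admissible (F C : Type) : Set (ClassicSpace F C) :=
  {w | (∀ i, 0 ≤ w.1 i) ∧ (∀ i j, 0 ≤ w.2 i j) ∧
    (∀ i i' j j', w.2 i j ≤ w.2 i' j + w.2 i' j' + w.2 i j')}

/-- The value of the linear objective function `w` at the point `s`. -/
def cost (w s : ClassicSpace F C) : ℝ :=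
  ∑ i, w.1 i * s.1 i + ∑ i, ∑ j, w.2 i j * s.2 i j

/-- The cost of an optimal mixed integer solution with respect to `w`. -/
noncomputable def CFLInstance.opt (I : CFLInstance F C) (w : ClassicSpace F C) : ℝ :=
  sInf (cost w '' I.feasible)

end Problem

section Product

variable {F C : Type} [Fintype F] [Fintype C]

/-- The coordinates of the mixed product space: `Sum.inl E` stands for the product variable
`z_E`, with `E` a nonempty set of facility variables, and `Sum.inr (E, i, j)` stands for
`z_{E x_ij}`, with `E` any set of facility variables; `z_{∅ x_ij}` is `x_ij` itself. -/
abbrev ProductIndex (F C : Type) : Type := {E : Finset F // E.Nonempty} ⊕ (Finset F × F × C)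

/-- The mixed product space. -/
abbrev ProductSpace (F C : Type) : Type := ProductIndex F C → ℝ

/-- The mixed product section. -/
def productSection (s : ClassicSpace F C) : ProductSpace F C
  | Sum.inl E => ∏ i ∈ E.1, s.1 i
  | Sum.inr (E, i, j) => (∏ i' ∈ E, s.1 i') * s.2 i j

/-- The canonical product relaxation: the convex hull of the mixed product section of the
feasible mixed integer solutions. -/
def CFLInstance.canonical (I : CFLInstance F C) : Set (ProductSpace F C) :=
  convexHull ℝ (productSection '' I.feasible)

/-- The projection of a product vector to the classic variables. -/
def classicPart (z : ProductSpace F C) : ClassicSpace F C :=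
  (fun i => z (Sum.inl ⟨{i}, Finset.singleton_nonempty i⟩), fun i j => z (Sum.inr (∅, i, j)))

/-- A product vector is `ρ`-gap inducing if, for some admissible objective function (extended by
zero to the other product coordinates), its cost is less than `ρ⁻¹` times the optimum. -/
def CFLInstance.GapInducing (I : CFLInstance F C) (ρ : ℝ) (z : ProductSpace F C) : Prop :=
  ∃ w ∈ admissible F C, cost w (classicPart z) < ρ⁻¹ * I.opt w

/-- A set of vectors of the unit cube outside the canonical product relaxation is conflicting if
its convex hull meets the canonical product relaxation. -/
def CFLInstance.Conflicting (I : CFLInstance F C) (s : Set (ProductSpace F C)) : Prop :=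
  s ⊆ Set.Icc 0 1 \ I.canonical ∧ (convexHull ℝ s ∩ I.canonical).Nonempty

/-- The hypergraph on a set `V` of product vectors whose hyperedges are the conflicting subsets
of `V`. -/
def CFLInstance.conflictHypergraph (I : CFLInstance F C) (V : Set (ProductSpace F C)) :
    Hypergraph (ProductSpace F C) where
  vertexSet := V
  edgeSet := {e | e ⊆ V ∧ I.Conflicting e}
  subset_vertexSet_of_mem_edgeSet' := fun _ he => he.1

end Product

/-- A hypergraph is colorable with `m` colors if its vertices can be colored in such a way that
no hyperedge is monochromatic. -/
def HypergraphColorable {α : Type} (H : Hypergraph α) (m : ℕ) : Prop :=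
  ∃ col : H.vertexSet → Fin m, ∀ e ∈ H.edgeSet, ∀ a : Fin m,
    ∃ v : H.vertexSet, v.1 ∈ e ∧ col v ≠ a

/-- The chromatic number of a hypergraph (`⊤` if no finite number of colors suffices). -/
noncomputable def hypergraphChromaticNumber {α : Type} (H : Hypergraph α) : ℕ∞ :=
  ⨅ m ∈ {m : ℕ | HypergraphColorable H m}, (m : ℕ∞)

section Extended

variable {F C : Type} [Fintype F] [Fintype C]

/-- A system of `r` linear inequalities in the classic variables `(y, x)` and `s` auxiliary
variables `u`. -/
structure LinearSystem (F C : Type) (r s : ℕ) where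
  coeffY : Fin r → F → ℝ
  coeffX : Fin r → F → C → ℝ
  coeffU : Fin r → Fin s → ℝ
  rhs : Fin r → ℝ

/-- The point with classic part `p` and auxiliary part `u` satisfies all inequalities. -/
def LinearSystem.Holds {r s : ℕ} (Q : LinearSystem F C r s) (p : ClassicSpace F C)
    (u : Fin s → ℝ) : Prop :=
  ∀ t, ∑ i, Q.coeffY t i * p.1 i + ∑ i, ∑ j, Q.coeffX t i j * p.2 i j +
    ∑ e, Q.coeffU t e * u e ≤ Q.rhs t

/-- The projection of the solution set to the classic variables. -/
def LinearSystem.proj {r s : ℕ} (Q : LinearSystem F C r s) : Set (ClassicSpace F C) :=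
  {p | ∃ u, Q.Holds p u}

/-- `Q` is a `ρ`-approximate extended formulation of the CFL polytope: it is an extended
relaxation (so that the minimum of any linear function over `Q` is at most the one over the
polytope), and for every admissible objective function the minimum over `Q` is at least `ρ⁻¹`
times the minimum over the polytope. -/
def LinearSystem.IsApproxEF {r s : ℕ} (Q : LinearSystem F C r s) (I : CFLInstance F C)
    (ρ : ℝ) : Prop :=
  I.polytope ⊆ Q.proj ∧
    ∀ w ∈ admissible F C, ∀ p ∈ Q.proj, ρ⁻¹ * sInf (cost w '' I.polytope) ≤ cost w p

/-- `Q` has a mixed-linear section: feasible mixed integer solutions `(y, x)` can be extended to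
solutions of `Q` by auxiliary values that, for each fixed `y`, are affine functions of `x`. -/
def LinearSystem.HasMixedLinearSection {r s : ℕ} (Q : LinearSystem F C r s)
    (I : CFLInstance F C) : Prop :=
  ∃ g : (F → ℝ) → ((F → C → ℝ) →ᵃ[ℝ] (Fin s → ℝ)), ∀ p ∈ I.feasible, Q.Holds p (g p.1 p.2)

end Extended

section Core

/-- The instance with `3n` facilities of capacity `U` and `n⁴ + 1` clients of unit demand, where
`(n⁴ + 1) - n U = 2 ^ (-n²)`. -/
noncomputable def hardInstance (n : ℕ) : CFLInstance (Fin (3 * n)) (Fin (n ^ 4 + 1)) where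
  capacity := fun _ => ((n : ℝ) ^ 4 + 1 - ((2 : ℝ) ^ (n ^ 2))⁻¹) / n
  demand := fun _ => 1

/-- The probability of the second case of the random experiment. -/
noncomputable def caseTwoProb (n : ℕ) : ℝ := 20 / ((n : ℝ) ^ 2 * (1 + 1 / n))

/-- The total demand taken in the second case by each open facility of `l`, that is
`(∑ j, x̄_ij) / (10 / n²)` with `x̄_ij = n⁻² / n` for each of the `n⁴ + 1` clients. -/
noncomputable def caseTwoLoad (n : ℕ) : ℝ :=
  (∑ _j : Fin (n ^ 4 + 1), ((n : ℝ) ^ 2)⁻¹ / n) / (10 / (n : ℝ) ^ 2)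

/-- The sets `q` of facilities among which the second case chooses uniformly. -/
def caseTwoSets {n : ℕ} (k l : Finset (Fin (3 * n))) : Finset (Finset (Fin (3 * n))) :=
  {q ∈ kᶜ.powerset | (q ∩ l).Nonempty}

/-- First case: exactly the facilities outside `l` are open, and the facilities in `k` share the
demand of every client evenly. -/
noncomputable def caseOne {n : ℕ} (k l : Finset (Fin (3 * n))) :
    ClassicSpace (Fin (3 * n)) (Fin (n ^ 4 + 1)) :=
  (fun i => if i ∈ l then 0 else 1, fun i _ => if i ∈ k then 1 / n else 0)

/-- Second case with outcome `q`: the facilities in `k` and in `q` are open. Each facility in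
`q ∩ l` takes `caseTwoLoad n` units of demand, in expectation the same amount from each of the
`n⁴ + 1` clients, and the rest of the demand is equally distributed to the facilities in `k`.
The vector below is the conditional expectation of `(y, x)` given `q`. -/
noncomputable def caseTwo {n : ℕ} (k l q : Finset (Fin (3 * n))) :
    ClassicSpace (Fin (3 * n)) (Fin (n ^ 4 + 1)) :=
  (fun i => if i ∈ k ∪ q then 1 else 0,
   fun i _ =>
    if i ∈ q ∩ l then caseTwoLoad n / ((n : ℝ) ^ 4 + 1)
    else if i ∈ k then (1 - (q ∩ l).card * (caseTwoLoad n / ((n : ℝ) ^ 4 + 1))) / n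
    else 0)

/-- The expectation of `g (y, x)` in the random experiment for `k` and `l`. -/
noncomputable def expect {n : ℕ} (k l : Finset (Fin (3 * n)))
    (g : ClassicSpace (Fin (3 * n)) (Fin (n ^ 4 + 1)) → ℝ) : ℝ :=
  (1 - caseTwoProb n) * g (caseOne k l) +
    ∑ q ∈ caseTwoSets k l, caseTwoProb n / (caseTwoSets k l).card * g (caseTwo k l q)

/-- The vector `z_{k,l}`: each product coordinate is the expectation of that product. -/
noncomputable def coreVector {n : ℕ} (k l : Finset (Fin (3 * n))) :
    ProductSpace (Fin (3 * n)) (Fin (n ^ 4 + 1)) :=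
  fun a => expect k l (fun s => productSection s a)

/-- The core: all vectors `z_{k,l}` with `l` a set of `n` facilities disjoint from `k`. -/
def core {n : ℕ} (k : Finset (Fin (3 * n))) :
    Set (ProductSpace (Fin (3 * n)) (Fin (n ^ 4 + 1))) :=
  {z | ∃ l : Finset (Fin (3 * n)), l.card = n ∧ Disjoint k l ∧ z = coreVector k l}

end Core

end CFL

/-!
The vector `z_{k,l}` is the mean of a random experiment that would be one on feasible solutions,
were it not for its first case, where the facilities in `k` have to serve everybody although their
joint capacity falls short of the demand by `2 ^ (-n²)`.

*Gap.* Let opening a facility in `l` cost `1` and put the facilities outside `k ∪ l` at distance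
`2 ^ (n²)` from all clients, the others at distance `0`. A feasible solution either opens a facility
in `l` or serves at least `2 ^ (-n²)` units from outside `k ∪ l`, so it costs at least `1`
(`one_le_cost_of_mem_feasible`). In the experiment only the second case incurs cost, at most `n`,
and it has probability about `20 / n²`, so the expected cost is below `20 / n`
(`cost_classicPart_coreVector_lt`). Hence `z_{k,l}` is `n / 20`-gap inducing and lies outside the
canonical product relaxation.

*Conflict.* Let `l ≠ l'`. The sum of the means for `l` and `l'` does not change when the two
experiments exchange their first cases (`hybridMean_add_swap`). After the exchange, the first case
for `l` meets the outcome `q = F \ (k ∪ l)` of the second case for `l'`, which opens the same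
facilities, and in which facilities in `l' \ l` relieve those in `k`. This outcome has probability
at least `2 ^ (-2n)` times that of the second case, which outweighs the overload `2 ^ (-n²)`:
averaging the two assignments gives a feasible solution (`hybridMean_mem_convexHull`). So for any
`Φ` that is affine in `x` for fixed `y`, the midpoint of the two means of `Φ` is a convex
combination of values of `Φ` at feasible solutions (`midpoint_mem_convexHull`).

With `Φ` the mixed product section, any two core vectors are conflicting, and they are distinct
because core vectors lie outside the canonical product relaxation. The conflict hypergraph is thus a
clique on `(2n).choose n` vertices. With `Φ` a mixed-linear section of an approximate extended
formulation, the gap makes each mean violate some inequality, and no inequality is violated for two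
sets `l`, since it would be violated at the midpoint (`choose_le_size`). There are therefore at
least `(2n).choose n ≥ 2 ^ n` inequalities.
-/

open CFL

/-! ### The expected vector of a mixed section -/

/-- The expectation of `Φ (y, x)` when the first case of the random experiment is the one for `l`
and the second case is the one for `l'`. The experiment `𝒟_{k,l}` itself is `l = l'`; the
hybrid with `l ≠ l'` arises by exchanging the first cases of two experiments. -/
noncomputable def hybridMean {n : ℕ} {V : Type*} [AddCommGroup V] [Module ℝ V]
    (k l l' : Finset (Fin (3 * n)))
    (Φ : ClassicSpace (Fin (3 * n)) (Fin (n ^ 4 + 1)) → V) : V :=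
  (1 - caseTwoProb n) • Φ (caseOne k l) +
    ∑ q ∈ caseTwoSets k l', (caseTwoProb n / (caseTwoSets k l').card) • Φ (caseTwo k l' q)

theorem map_hybridMean {n : ℕ} {V W : Type*} [AddCommGroup V] [Module ℝ V] [AddCommGroup W]
    [Module ℝ W] (L : V →ₗ[ℝ] W) (k l l' : Finset (Fin (3 * n)))
    (Φ : ClassicSpace (Fin (3 * n)) (Fin (n ^ 4 + 1)) → V) :
    L (hybridMean k l l' Φ) = hybridMean k l l' (fun s => L (Φ s)) := by
  simp [hybridMean, map_add, map_sum]

theorem coreVector_eq_hybridMean {n : ℕ} (k l : Finset (Fin (3 * n))) :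
    coreVector k l = hybridMean k l l productSection := by
  funext a
  simp [coreVector, expect, hybridMean, Finset.sum_apply]

theorem hybridMean_add_swap {n : ℕ} {V : Type*} [AddCommGroup V] [Module ℝ V]
    (k l l' : Finset (Fin (3 * n)))
    (Φ : ClassicSpace (Fin (3 * n)) (Fin (n ^ 4 + 1)) → V) :
    hybridMean k l l Φ + hybridMean k l' l' Φ =
      hybridMean k l l' Φ + hybridMean k l' l Φ := by
  simp only [hybridMean]
  abel

/-! ### Numerical estimates -/

theorem caseTwoProb_eq {n : ℕ} (hn : 0 < n) : caseTwoProb n = 20 / ((n : ℝ) ^ 2 + n) := by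
  have : (0 : ℝ) < n := by exact_mod_cast hn
  unfold caseTwoProb
  congr 1
  field_simp

theorem caseTwoProb_pos {n : ℕ} (hn : 0 < n) : 0 < caseTwoProb n := by
  rw [caseTwoProb_eq hn]
  positivity

theorem caseTwoProb_lt_one {n : ℕ} (hn : 21 ≤ n) : caseTwoProb n < 1 := by
  have h : (21 : ℝ) ≤ n := by exact_mod_cast hn
  rw [caseTwoProb_eq (by omega), div_lt_one (by positivity)]
  nlinarith

theorem caseTwoLoad_div_demand {n : ℕ} (hn : 0 < n) :
    caseTwoLoad n / ((n : ℝ) ^ 4 + 1) = 1 / (10 * n) := by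
  have : (0 : ℝ) < n := by exact_mod_cast hn
  simp only [caseTwoLoad, Finset.sum_const, Finset.card_univ, Fintype.card_fin, nsmul_eq_mul]
  push_cast
  field_simp

theorem mem_caseTwoSets {n : ℕ} {k l q : Finset (Fin (3 * n))} :
    q ∈ caseTwoSets k l ↔ Disjoint k q ∧ (q ∩ l).Nonempty := by
  simp only [caseTwoSets, Finset.mem_filter, Finset.mem_powerset,
    Finset.subset_compl_iff_disjoint_left]

theorem card_caseTwoSets_le {n : ℕ} {k l : Finset (Fin (3 * n))} (hk : k.card = n) :
    (caseTwoSets k l).card ≤ 2 ^ (2 * n) := by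
  refine (Finset.card_filter_le _ _).trans ?_
  rw [Finset.card_powerset, Finset.card_compl, hk, Fintype.card_fin]
  exact Nat.pow_le_pow_right (by norm_num) (by omega)

/-- Even the least likely outcome of the second case moves more demand away from `k` than the
excess `2 ^ (-n²)` of the total demand over the capacity of `k`. -/
theorem excess_le {n : ℕ} (hn : 21 ≤ n) {k l : Finset (Fin (3 * n))} (hk : k.card = n)
    (hS : (caseTwoSets k l).Nonempty) :
    ((2 : ℝ) ^ (n ^ 2))⁻¹ ≤ ((n : ℝ) ^ 4 + 1) *
      (caseTwoProb n / (caseTwoSets k l).card * (1 / (10 * n))) := by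
  have h : (21 : ℝ) ≤ n := by exact_mod_cast hn
  have h0 : (0 : ℝ) < n := by linarith
  have hc : (0 : ℝ) < (caseTwoSets k l).card := by exact_mod_cast hS.card_pos
  have hc' : ((caseTwoSets k l).card : ℝ) ≤ 2 ^ (n ^ 2) := by
    calc ((caseTwoSets k l).card : ℝ) ≤ 2 ^ (2 * n) := by
          exact_mod_cast card_caseTwoSets_le (l := l) hk
      _ ≤ 2 ^ (n ^ 2) := pow_le_pow_right₀ (by norm_num) (by nlinarith)
  have h1 : 1 ≤ ((n : ℝ) ^ 4 + 1) * (caseTwoProb n * (1 / (10 * n))) := by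
    rw [caseTwoProb_eq (by omega)]
    have : ((n : ℝ) ^ 4 + 1) * (20 / ((n : ℝ) ^ 2 + n) * (1 / (10 * n))) =
        (2 * ((n : ℝ) ^ 4 + 1)) / (n ^ 3 + n ^ 2) := by
      field_simp
      ring
    rw [this, le_div_iff₀ (by positivity)]
    have h3 : (n : ℝ) ^ 3 ≤ n ^ 4 := pow_le_pow_right₀ (by linarith) (by norm_num)
    have h2 : (n : ℝ) ^ 2 ≤ n ^ 4 := pow_le_pow_right₀ (by linarith) (by norm_num)
    linarith
  calc ((2 : ℝ) ^ (n ^ 2))⁻¹ ≤ ((caseTwoSets k l).card : ℝ)⁻¹ := inv_anti₀ hc hc'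
    _ = ((caseTwoSets k l).card : ℝ)⁻¹ * 1 := (mul_one _).symm
    _ ≤ ((caseTwoSets k l).card : ℝ)⁻¹ *
        (((n : ℝ) ^ 4 + 1) * (caseTwoProb n * (1 / (10 * n)))) := by gcongr
    _ = _ := by rw [div_eq_mul_inv]; ring

/-! ### Feasible solutions -/

/-- Exactly the facilities in `O` are open, each facility in `A` serves the fraction `α` of every
client, and the facilities in `k` share the rest evenly. -/
noncomputable def sharedSolution {n : ℕ} (O k A : Finset (Fin (3 * n))) (α : ℝ) :
    ClassicSpace (Fin (3 * n)) (Fin (n ^ 4 + 1)) :=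
  (fun i => if i ∈ O then 1 else 0,
   fun i _ => if i ∈ A then α else if i ∈ k then (1 - A.card * α) / n else 0)

theorem sharedSolution_mem_feasible {n : ℕ} (hn : 21 ≤ n) {O k A : Finset (Fin (3 * n))} {α : ℝ}
    (hk : k.card = n) (hkO : k ⊆ O) (hAO : A ⊆ O) (hkA : Disjoint k A) (hA : A.card ≤ n)
    (hα0 : 0 ≤ α) (hα : α ≤ 1 / (10 * n))
    (hex : ((2 : ℝ) ^ (n ^ 2))⁻¹ ≤ ((n : ℝ) ^ 4 + 1) * (A.card * α)) :
    sharedSolution O k A α ∈ (hardInstance n).feasible := by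
  have h : (21 : ℝ) ≤ n := by exact_mod_cast hn
  have h0 : (0 : ℝ) < n := by linarith
  have hAn : (A.card : ℝ) ≤ n := by exact_mod_cast hA
  have hAα : A.card * α ≤ 1 / 10 := by
    calc A.card * α ≤ n * (1 / (10 * n)) := by gcongr
      _ = 1 / 10 := by field_simp
  have hAα0 : 0 ≤ A.card * α := by positivity
  have hε : ((2 : ℝ) ^ (n ^ 2))⁻¹ ≤ 1 := inv_le_one_of_one_le₀ (one_le_pow₀ (by norm_num))
  have hn4 : (1 : ℝ) ≤ (n : ℝ) ^ 4 := one_le_pow₀ (by linarith)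
  have hα1 : α ≤ 1 := hα.trans (by rw [div_le_one (by positivity)]; linarith)
  have hk0 : 0 ≤ (1 - A.card * α) / n := div_nonneg (by linarith) h0.le
  have hk1 : (1 - A.card * α) / n ≤ 1 := by rw [div_le_one h0]; linarith
  refine ⟨fun i => ?_, fun i j => ⟨?_, ?_⟩, fun j => ?_, fun i => ?_⟩
  · by_cases hi : i ∈ O <;> simp [sharedSolution, hi]
  · simp only [sharedSolution]
    split_ifs <;> first | assumption | exact le_rfl
  · simp only [sharedSolution]
    by_cases hiA : i ∈ A
    · simpa [hiA, hAO hiA] using hα1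
    · by_cases hik : i ∈ k
      · simpa [hiA, hik, hkO hik] using hk1
      · simp only [hiA, hik, if_false]
        split_ifs <;> norm_num
  · have hsplit : ∀ i, (sharedSolution O k A α).2 i j =
        (if i ∈ A then α else 0) + (if i ∈ k then (1 - A.card * α) / n else 0) := by
      intro i
      by_cases hiA : i ∈ A
      · simp [sharedSolution, hiA, Finset.disjoint_right.mp hkA hiA]
      · simp [sharedSolution, hiA]
    simp only [hsplit, Finset.sum_add_distrib, Finset.sum_ite_mem, Finset.univ_inter,
      Finset.sum_const, nsmul_eq_mul, hk]
    field_simp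
    ring
  · simp only [hardInstance, sharedSolution, one_mul, Finset.sum_const, Finset.card_univ,
      Fintype.card_fin, nsmul_eq_mul]
    push_cast
    rw [div_mul_eq_mul_div, le_div_iff₀ h0]
    by_cases hiA : i ∈ A
    · simp only [hiA, hAO hiA, if_true]
      have : α * n ≤ 1 / 10 := by
        calc α * n ≤ 1 / (10 * n) * n := by gcongr
          _ = 1 / 10 := by field_simp
      nlinarith
    · by_cases hik : i ∈ k
      · simp only [hiA, hik, hkO hik, if_true, if_false]
        rw [mul_assoc, div_mul_cancel₀ _ h0.ne']
        linarith
      · simp only [hiA, hik, if_false]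
        split_ifs
        · linarith
        · simp

theorem caseOne_eq_sharedSolution {n : ℕ} {k l A : Finset (Fin (3 * n))} (hkA : Disjoint k A) :
    caseOne k l = sharedSolution lᶜ k A 0 := by
  ext i
  · by_cases hi : i ∈ l <;> simp [caseOne, sharedSolution, hi]
  · by_cases hi : i ∈ A
    · simp [caseOne, sharedSolution, hi, Finset.disjoint_right.mp hkA hi]
    · simp [caseOne, sharedSolution, hi]

theorem caseTwo_eq_sharedSolution {n : ℕ} (hn : 0 < n) (k l q : Finset (Fin (3 * n))) :
    caseTwo k l q = sharedSolution (k ∪ q) k (q ∩ l) (1 / (10 * n)) := by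
  simp only [caseTwo, sharedSolution, caseTwoLoad_div_demand hn]

theorem sharedSolution_convexComb {n : ℕ} (O k A : Finset (Fin (3 * n))) {a b : ℝ} (hab : a + b = 1)
    (α β : ℝ) :
    sharedSolution O k A (a * α + b * β) =
      ((sharedSolution O k A α).1,
        a • (sharedSolution O k A α).2 + b • (sharedSolution O k A β).2) := by
  ext i j
  · rfl
  · obtain rfl : b = 1 - a := by linarith
    simp only [sharedSolution, Pi.add_apply, Pi.smul_apply, smul_eq_mul]
    split_ifs <;> ring

theorem caseTwo_mem_feasible {n : ℕ} (hn : 21 ≤ n) {k l q : Finset (Fin (3 * n))}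
    (hk : k.card = n) (hl : l.card = n) (hq : q ∈ caseTwoSets k l) :
    caseTwo k l q ∈ (hardInstance n).feasible := by
  have hq' := mem_caseTwoSets.mp hq
  have h0 : (0 : ℝ) < n := by exact_mod_cast (by omega : 0 < n)
  rw [caseTwo_eq_sharedSolution (by omega)]
  have hS : (caseTwoSets k l).Nonempty := ⟨q, hq⟩
  have hA1 : (1 : ℝ) ≤ (q ∩ l).card := by exact_mod_cast hq'.2.card_pos
  have hc : (1 : ℝ) ≤ (caseTwoSets k l).card := by exact_mod_cast hS.card_pos
  refine sharedSolution_mem_feasible hn hk Finset.subset_union_left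
    (Finset.inter_subset_left.trans Finset.subset_union_right)
    (hq'.1.mono_right Finset.inter_subset_left)
    ((Finset.card_le_card Finset.inter_subset_right).trans hl.le) (by positivity) le_rfl
    ((excess_le hn hk hS).trans ?_)
  gcongr
  exact ((div_le_one (by linarith)).mpr ((caseTwoProb_lt_one hn).le.trans hc)).trans hA1

/-! ### Exchanging first cases makes the experiments feasible -/

/-- For each fixed `y`, the map `Φ` is affine in `x`. -/
def IsMixedAffine {F C : Type} {V : Type*} [AddCommGroup V] [Module ℝ V]
    (Φ : ClassicSpace F C → V) : Prop :=
  ∀ (y : F → ℝ) (x x' : F → C → ℝ) (a b : ℝ), a + b = 1 →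
    Φ (y, a • x + b • x') = a • Φ (y, x) + b • Φ (y, x')

theorem isMixedAffine_productSection {F C : Type} [Fintype F] [Fintype C] :
    IsMixedAffine (productSection (F := F) (C := C)) := by
  intro y x x' a b hab
  obtain rfl : b = 1 - a := by linarith
  funext c
  rcases c with E | ⟨E, i, j⟩ <;>
    simp only [productSection, Pi.add_apply, Pi.smul_apply, smul_eq_mul] <;> ring

/-- If `l ≠ l'`, then one of the outcomes of the second case for `l'` opens the same facilities as
the first case for `l`. There, the demand that the facilities in `k` are relieved of is more than
what they are overloaded with in the first case, so averaging the two assignments gives a feasible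
solution, and the hybrid experiment has the same mean as one on feasible solutions only. -/
theorem hybridMean_mem_convexHull {n : ℕ} (hn : 21 ≤ n) {k l l' : Finset (Fin (3 * n))}
    (hk : k.card = n) (hl : l.card = n) (hl' : l'.card = n) (hkl : Disjoint k l)
    (hkl' : Disjoint k l') (hne : l ≠ l') {V : Type*} [AddCommGroup V] [Module ℝ V]
    {Φ : ClassicSpace (Fin (3 * n)) (Fin (n ^ 4 + 1)) → V} (hΦ : IsMixedAffine Φ) :
    hybridMean k l l' Φ ∈ convexHull ℝ (Φ '' (hardInstance n).feasible) := by
  -- With the outcome `q₀` the second case for `l'` opens exactly the facilities outside `l`.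
  set q₀ : Finset (Fin (3 * n)) := (k ∪ l)ᶜ with hq₀
  set A := q₀ ∩ l' with hA
  have hmemA : A.Nonempty := by
    obtain ⟨i, hi', hi⟩ : ∃ i ∈ l', i ∉ l := by
      by_contra! hcon
      exact hne (Finset.eq_of_subset_of_card_le hcon (by omega)).symm
    exact ⟨i, by simp [hA, hq₀, hi, hi', Finset.disjoint_right.mp hkl' hi']⟩
  have hkq : Disjoint k q₀ := by
    rw [hq₀, ← Finset.subset_compl_iff_disjoint_left]
    exact Finset.compl_subset_compl.mpr Finset.subset_union_left
  have hkA : Disjoint k A := hkq.mono_right Finset.inter_subset_left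
  have hq : q₀ ∈ caseTwoSets k l' := mem_caseTwoSets.mpr ⟨hkq, hmemA⟩
  have hopen : k ∪ q₀ = lᶜ := by
    ext i
    have hi : i ∈ k → i ∉ l := fun h => Finset.disjoint_left.mp hkl h
    simp only [hq₀, Finset.mem_union, Finset.mem_compl]
    tauto
  have hS : (caseTwoSets k l').Nonempty := ⟨q₀, hq⟩
  have h0 : (0 : ℝ) < n := by exact_mod_cast (by omega : 0 < n)
  have hT : (1 : ℝ) ≤ (caseTwoSets k l').card := by exact_mod_cast hS.card_pos
  set p := caseTwoProb n with hp
  set b := p / (caseTwoSets k l').card with hb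
  have hp0 : 0 < p := caseTwoProb_pos (by omega)
  have hp1 : p < 1 := caseTwoProb_lt_one hn
  have hb0 : 0 < b := div_pos hp0 (by linarith)
  have hbp : b ≤ p := div_le_self hp0.le hT
  have hTb : (caseTwoSets k l').card * b = p := by rw [hb]; field_simp
  have hab0 : 0 < 1 - p + b := by linarith
  -- The two assignments are shared solutions in which each facility in `A` serves the fraction `0`
  -- and `1 / (10 n)`; `α` is the fraction in their average with weights `1 - p` and `b`.
  set α : ℝ := b / (1 - p + b) * (1 / (10 * n)) with hα
  have hbα : b ≤ b / (1 - p + b) := by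
    rw [le_div_iff₀ hab0]
    nlinarith
  have hA1 : (1 : ℝ) ≤ A.card := by exact_mod_cast hmemA.card_pos
  have hαb : b * (1 / (10 * n)) ≤ α := by
    rw [hα]
    gcongr
  have hfeas : sharedSolution (k ∪ q₀) k A α ∈ (hardInstance n).feasible := by
    refine sharedSolution_mem_feasible hn hk Finset.subset_union_left
      (Finset.inter_subset_left.trans Finset.subset_union_right) hkA
      ((Finset.card_le_card Finset.inter_subset_right).trans hl'.le) (by positivity) ?_
      ((excess_le hn hk hS).trans ?_)
    · refine mul_le_of_le_one_left (by positivity) ?_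
      rw [div_le_one hab0]
      linarith
    · refine mul_le_mul_of_nonneg_left (hαb.trans ?_) (by positivity)
      exact le_mul_of_one_le_left (by positivity) hA1
  have hmerge : (1 - p + b) • Φ (sharedSolution (k ∪ q₀) k A α) =
      (1 - p) • Φ (caseOne k l) + b • Φ (caseTwo k l' q₀) := by
    have hsum : (1 - p) / (1 - p + b) + b / (1 - p + b) = 1 := by
      rw [← add_div, div_self hab0.ne']
    have h1 : α = (1 - p) / (1 - p + b) * 0 + b / (1 - p + b) * (1 / (10 * n)) := by
      rw [hα]
      ring
    rw [caseOne_eq_sharedSolution hkA, caseTwo_eq_sharedSolution (by omega), ← hopen, h1,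
      sharedSolution_convexComb _ _ _ hsum, hΦ _ _ _ _ _ hsum, smul_add, smul_smul, smul_smul,
      mul_div_cancel₀ _ hab0.ne', mul_div_cancel₀ _ hab0.ne']
    rfl
  have hrw : hybridMean k l l' Φ = (1 - p + b) • Φ (sharedSolution (k ∪ q₀) k A α) +
      ∑ q ∈ (caseTwoSets k l').erase q₀, b • Φ (caseTwo k l' q) := by
    rw [hmerge, add_assoc, Finset.add_sum_erase _ (fun q => b • Φ (caseTwo k l' q)) hq]
    rfl
  -- The weight of the outcome `q₀` has absorbed the one of the first case.
  have hsum1 : ∑ q ∈ caseTwoSets k l', (if q = q₀ then 1 - p + b else b) = 1 := by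
    rw [← Finset.add_sum_erase _ _ hq, if_pos rfl,
      Finset.sum_congr rfl (fun q hq' => if_neg (Finset.ne_of_mem_erase hq')), Finset.sum_const,
      nsmul_eq_mul, Finset.card_erase_of_mem hq, Nat.cast_sub hS.card_pos]
    push_cast
    linarith
  have hmem := (convex_convexHull ℝ (Φ '' (hardInstance n).feasible)).sum_mem
    (t := caseTwoSets k l') (w := fun q => if q = q₀ then 1 - p + b else b)
    (z := fun q => Φ (if q = q₀ then sharedSolution (k ∪ q₀) k A α else caseTwo k l' q))
    (fun q _ => by split_ifs <;> linarith) hsum1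
    (fun q hqS => by
      refine subset_convexHull ℝ _ (Set.mem_image_of_mem _ ?_)
      split_ifs
      · exact hfeas
      · exact caseTwo_mem_feasible hn hk hl' hqS)
  rw [← Finset.add_sum_erase _ _ hq, if_pos rfl, if_pos rfl] at hmem
  rw [hrw]
  convert hmem using 2
  refine Finset.sum_congr rfl fun q hq' => ?_
  rw [if_neg (Finset.ne_of_mem_erase hq'), if_neg (Finset.ne_of_mem_erase hq')]

/-- The midpoint of the means for two distinct sets `l`, `l'` is a mean over feasible solutions. -/
theorem midpoint_mem_convexHull {n : ℕ} (hn : 21 ≤ n) {k l l' : Finset (Fin (3 * n))}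
    (hk : k.card = n) (hl : l.card = n) (hl' : l'.card = n) (hkl : Disjoint k l)
    (hkl' : Disjoint k l') (hne : l ≠ l') {V : Type*} [AddCommGroup V] [Module ℝ V]
    {Φ : ClassicSpace (Fin (3 * n)) (Fin (n ^ 4 + 1)) → V} (hΦ : IsMixedAffine Φ) :
    midpoint ℝ (hybridMean k l l Φ) (hybridMean k l' l' Φ) ∈
      convexHull ℝ (Φ '' (hardInstance n).feasible) := by
  rw [midpoint_eq_smul_add, hybridMean_add_swap, ← midpoint_eq_smul_add]
  exact (convex_convexHull ℝ _).midpoint_mem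
    (hybridMean_mem_convexHull hn hk hl hl' hkl hkl' hne hΦ)
    (hybridMean_mem_convexHull hn hk hl' hl hkl' hkl hne.symm hΦ)

/-! ### The gap -/

theorem isLinearMap_cost {F C : Type} [Fintype F] [Fintype C] (w : ClassicSpace F C) :
    IsLinearMap ℝ (cost w) := by
  constructor
  · intro s t
    simp only [cost, Prod.fst_add, Prod.snd_add, Pi.add_apply, mul_add, Finset.sum_add_distrib]
    ring
  · intro a s
    simp only [cost, Prod.smul_fst, Prod.smul_snd, Pi.smul_apply, smul_eq_mul, mul_add,
      Finset.mul_sum]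
    congr 1
    · exact Finset.sum_congr rfl fun i _ => by ring
    · exact Finset.sum_congr rfl fun i _ => Finset.sum_congr rfl fun j _ => by ring

/-- The projection of product vectors to the classic variables, as a linear map. -/
def classicPartLinear (F C : Type) [Fintype F] [Fintype C] :
    ProductSpace F C →ₗ[ℝ] ClassicSpace F C where
  toFun := classicPart
  map_add' _ _ := rfl
  map_smul' _ _ := rfl

theorem classicPart_productSection {F C : Type} [Fintype F] [Fintype C] (s : ClassicSpace F C) :
    classicPart (productSection s) = s := by
  simp [classicPart, productSection]

theorem classicPart_coreVector {n : ℕ} (k l : Finset (Fin (3 * n))) :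
    classicPart (coreVector k l) = hybridMean k l l (fun s => s) := by
  rw [coreVector_eq_hybridMean]
  refine (map_hybridMean (classicPartLinear _ _) k l l _).trans ?_
  congr 1
  funext s
  exact classicPart_productSection s

/-- The objective function that separates `z_{k,l}`: opening a facility in `l` costs `1`, and all
clients are at distance `2 ^ (n²)` from the facilities outside `k ∪ l` and at distance `0` from
the others. -/
noncomputable def separatingCost {n : ℕ} (k l : Finset (Fin (3 * n))) :
    ClassicSpace (Fin (3 * n)) (Fin (n ^ 4 + 1)) :=
  (fun i => if i ∈ l then 1 else 0, fun i _ => if i ∈ k ∪ l then 0 else 2 ^ (n ^ 2))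

theorem separatingCost_mem_admissible {n : ℕ} (k l : Finset (Fin (3 * n))) :
    separatingCost k l ∈ admissible (Fin (3 * n)) (Fin (n ^ 4 + 1)) := by
  have hD : (0 : ℝ) ≤ 2 ^ (n ^ 2) := by positivity
  refine ⟨fun i => ?_, fun i j => ?_, fun i i' j j' => ?_⟩ <;> simp only [separatingCost] <;>
    split_ifs <;> linarith

/-- A feasible solution that opens no facility of `l` has to serve the demand exceeding the capacity
of `k` from outside `k ∪ l`, and the distance is chosen so that this costs at least `1`. -/
theorem one_le_cost_of_mem_feasible {n : ℕ} (hn : 21 ≤ n) {k l : Finset (Fin (3 * n))}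
    (hk : k.card = n) (hkl : Disjoint k l) {s : ClassicSpace (Fin (3 * n)) (Fin (n ^ 4 + 1))}
    (hs : s ∈ (hardInstance n).feasible) : 1 ≤ cost (separatingCost k l) s := by
  obtain ⟨hy, hx, hd, hcap⟩ := hs
  have h0 : (0 : ℝ) < n := by exact_mod_cast (by omega : 0 < n)
  have hy0 : ∀ i, 0 ≤ s.1 i := fun i => by rcases hy i with h | h <;> simp [h]
  have hf : ∀ i, 0 ≤ (separatingCost k l).1 i * s.1 i := fun i =>
    mul_nonneg ((separatingCost_mem_admissible k l).1 i) (hy0 i)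
  have hc : ∀ i j, 0 ≤ (separatingCost k l).2 i j * s.2 i j := fun i j =>
    mul_nonneg ((separatingCost_mem_admissible k l).2.1 i j) (hx i j).1
  have hcsum : 0 ≤ ∑ i, ∑ j, (separatingCost k l).2 i j * s.2 i j :=
    Finset.sum_nonneg fun i _ => Finset.sum_nonneg fun j _ => hc i j
  by_cases hex : ∃ i ∈ l, s.1 i = 1
  · obtain ⟨i, hil, hi⟩ := hex
    have := Finset.single_le_sum (fun i _ => hf i) (Finset.mem_univ i)
    have h1 : (separatingCost k l).1 i * s.1 i = 1 := by simp [separatingCost, hil, hi]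
    simp only [cost]
    linarith
  · push Not at hex
    have hxl : ∀ i ∈ l, ∀ j, s.2 i j = 0 := fun i hi j => by
      have hi0 : s.1 i = 0 := (hy i).resolve_right (hex i hi)
      exact le_antisymm (hi0 ▸ (hx i j).2) (hx i j).1
    have hfsum : 0 ≤ ∑ i, (separatingCost k l).1 i * s.1 i := Finset.sum_nonneg fun i _ => hf i
    have htot : ∑ i, ∑ j, s.2 i j = (n : ℝ) ^ 4 + 1 := by
      rw [Finset.sum_comm, Finset.sum_congr rfl fun j _ => hd j]
      simp
    have hkcap : ∑ i ∈ k, ∑ j, s.2 i j ≤ (n : ℝ) ^ 4 + 1 - ((2 : ℝ) ^ (n ^ 2))⁻¹ := by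
      calc ∑ i ∈ k, ∑ j, s.2 i j
          ≤ ∑ i ∈ k, ((n : ℝ) ^ 4 + 1 - ((2 : ℝ) ^ (n ^ 2))⁻¹) / n := by
            refine Finset.sum_le_sum fun i _ => ?_
            have hU : 0 ≤ ((n : ℝ) ^ 4 + 1 - ((2 : ℝ) ^ (n ^ 2))⁻¹) / n := by
              have : ((2 : ℝ) ^ (n ^ 2))⁻¹ ≤ 1 :=
                inv_le_one_of_one_le₀ (one_le_pow₀ (by norm_num))
              have : (0 : ℝ) ≤ (n : ℝ) ^ 4 := by positivity
              exact div_nonneg (by linarith) h0.le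
            have h := hcap i
            simp only [hardInstance, one_mul] at h
            rcases hy i with hi | hi <;> rw [hi] at h <;> linarith
        _ = _ := by
            rw [Finset.sum_const, hk, nsmul_eq_mul]
            field_simp
    have hsplit : ∑ i ∈ (k ∪ l)ᶜ, ∑ j, s.2 i j + ∑ i ∈ k, ∑ j, s.2 i j = (n : ℝ) ^ 4 + 1 := by
      rw [← htot, ← Finset.sum_compl_add_sum (k ∪ l), Finset.sum_union hkl,
        Finset.sum_eq_zero (s := l) fun i hi => Finset.sum_eq_zero fun j _ => hxl i hi j, add_zero]
    have hcost : ∑ i, ∑ j, (separatingCost k l).2 i j * s.2 i j =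
        2 ^ (n ^ 2) * ∑ i ∈ (k ∪ l)ᶜ, ∑ j, s.2 i j := by
      rw [← Finset.sum_compl_add_sum (k ∪ l), Finset.sum_eq_zero (s := k ∪ l), add_zero,
        Finset.mul_sum]
      · refine Finset.sum_congr rfl fun i hi => ?_
        rw [Finset.mul_sum]
        exact Finset.sum_congr rfl fun j _ => by
          simp only [separatingCost, if_neg (Finset.mem_compl.mp hi)]
      · intro i hi
        exact Finset.sum_eq_zero fun j _ => by simp only [separatingCost, if_pos hi, zero_mul]
    have hge : ((2 : ℝ) ^ (n ^ 2))⁻¹ ≤ ∑ i ∈ (k ∪ l)ᶜ, ∑ j, s.2 i j := by linarith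
    have h2 : (0 : ℝ) < 2 ^ (n ^ 2) := by positivity
    have := mul_le_mul_of_nonneg_left hge h2.le
    rw [mul_inv_cancel₀ h2.ne'] at this
    simp only [cost] at *
    linarith

theorem caseTwoSets_nonempty {n : ℕ} (hn : 0 < n) {k l : Finset (Fin (3 * n))} (hl : l.card = n)
    (hkl : Disjoint k l) : (caseTwoSets k l).Nonempty :=
  ⟨l, mem_caseTwoSets.mpr ⟨hkl, by rw [Finset.inter_self, ← Finset.card_pos]; omega⟩⟩

/-- The expected cost is at most the probability of the second case times `|l|`. -/
theorem cost_classicPart_coreVector_lt {n : ℕ} (hn : 21 ≤ n) {k l : Finset (Fin (3 * n))}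
    (hl : l.card = n) (hkl : Disjoint k l) :
    cost (separatingCost k l) (classicPart (coreVector k l)) < 20 / n := by
  have h0 : (0 : ℝ) < n := by exact_mod_cast (by omega : 0 < n)
  have hp0 : 0 < caseTwoProb n := caseTwoProb_pos (by omega)
  have hT : (0 : ℝ) < (caseTwoSets k l).card := by
    exact_mod_cast (caseTwoSets_nonempty (by omega) hl hkl).card_pos
  have h1 : cost (separatingCost k l) (caseOne k l) = 0 := by
    simp only [cost]
    rw [Finset.sum_eq_zero, Finset.sum_eq_zero, add_zero]
    · intro i _
      refine Finset.sum_eq_zero fun j _ => ?_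
      by_cases hi : i ∈ k <;> simp [separatingCost, caseOne, hi]
    · intro i _
      by_cases hi : i ∈ l <;> simp [separatingCost, caseOne, hi]
  have h2 : ∀ q, cost (separatingCost k l) (caseTwo k l q) ≤ n := by
    intro q
    simp only [cost]
    rw [Finset.sum_eq_zero (f := fun i => ∑ j, (separatingCost k l).2 i j * _), add_zero]
    · calc ∑ i, (separatingCost k l).1 i * (caseTwo k l q).1 i
          ≤ ∑ i, if i ∈ l then (1 : ℝ) else 0 := by
            refine Finset.sum_le_sum fun i _ => ?_
            simp only [separatingCost, caseTwo]
            split_ifs <;> norm_num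
        _ = n := by simp [hl]
    · intro i _
      refine Finset.sum_eq_zero fun j _ => ?_
      by_cases hik : i ∈ k
      · simp [separatingCost, hik]
      · by_cases hil : i ∈ l
        · simp [separatingCost, hil]
        · simp [caseTwo, hik, hil]
  rw [classicPart_coreVector]
  have hmap := map_hybridMean ((isLinearMap_cost (separatingCost k l)).mk' _) k l l (fun s => s)
  simp only [IsLinearMap.mk'_apply] at hmap
  rw [hmap, hybridMean, h1, smul_zero, zero_add]
  calc ∑ q ∈ caseTwoSets k l, (caseTwoProb n / (caseTwoSets k l).card) •
          cost (separatingCost k l) (caseTwo k l q)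
      ≤ ∑ q ∈ caseTwoSets k l, (caseTwoProb n / (caseTwoSets k l).card) * n := by
        refine Finset.sum_le_sum fun q _ => ?_
        rw [smul_eq_mul]
        exact mul_le_mul_of_nonneg_left (h2 q) (by positivity)
    _ = caseTwoProb n * n := by
        rw [Finset.sum_const, nsmul_eq_mul]
        field_simp
    _ < 20 / n := by
        rw [caseTwoProb_eq (by omega), div_mul_eq_mul_div, div_lt_div_iff₀ (by positivity) h0]
        nlinarith

theorem le_apply_of_mem_convexHull_image {V X : Type*} [AddCommGroup V] [Module ℝ V] {Φ : X → V}
    {S : Set X} (L : V →ₗ[ℝ] ℝ) {a : ℝ} (h : ∀ s ∈ S, a ≤ L (Φ s)) {v : V}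
    (hv : v ∈ convexHull ℝ (Φ '' S)) : a ≤ L v := by
  have hsub : Φ '' S ⊆ {v | a ≤ L v} := by
    rintro _ ⟨s, hs, rfl⟩
    exact h s hs
  exact convexHull_min hsub (convex_halfSpace_ge L.isLinear a) hv

theorem coreVector_notMem_canonical {n : ℕ} (hn : 21 ≤ n) {k l : Finset (Fin (3 * n))}
    (hk : k.card = n) (hl : l.card = n) (hkl : Disjoint k l) :
    coreVector k l ∉ (hardInstance n).canonical := by
  intro hmem
  have hle := le_apply_of_mem_convexHull_image (a := 1)
    (((isLinearMap_cost (separatingCost k l)).mk' _).comp (classicPartLinear _ _))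
    (fun s hs => by
      change 1 ≤ cost _ (classicPart (productSection s))
      rw [classicPart_productSection]
      exact one_le_cost_of_mem_feasible hn hk hkl hs) hmem
  have hlt := cost_classicPart_coreVector_lt hn hl hkl
  have h : (21 : ℝ) ≤ n := by exact_mod_cast hn
  have : (20 : ℝ) / n ≤ 1 := by rw [div_le_one (by linarith)]; linarith
  exact absurd (hle.trans_lt hlt) this.not_gt

theorem feasible_nonempty {n : ℕ} (hn : 21 ≤ n) {k l : Finset (Fin (3 * n))} (hk : k.card = n)
    (hl : l.card = n) (hkl : Disjoint k l) : (hardInstance n).feasible.Nonempty := by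
  obtain ⟨q, hq⟩ := caseTwoSets_nonempty (by omega) hl hkl
  exact ⟨_, caseTwo_mem_feasible hn hk hl hq⟩

theorem coreVector_gapInducing {n : ℕ} (hn : 21 ≤ n) {k l : Finset (Fin (3 * n))}
    (hk : k.card = n) (hl : l.card = n) (hkl : Disjoint k l) :
    (hardInstance n).GapInducing (1 / 20 * n) (coreVector k l) := by
  refine ⟨separatingCost k l, separatingCost_mem_admissible k l,
    (cost_classicPart_coreVector_lt hn hl hkl).trans_le ?_⟩
  have h0 : (0 : ℝ) < n := by exact_mod_cast (by omega : 0 < n)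
  have hopt : 1 ≤ (hardInstance n).opt (separatingCost k l) := by
    refine le_csInf ((feasible_nonempty hn hk hl hkl).image _) ?_
    rintro _ ⟨s, hs, rfl⟩
    exact one_le_cost_of_mem_feasible hn hk hkl hs
  calc (20 : ℝ) / n = (1 / 20 * n : ℝ)⁻¹ * 1 := by field_simp
    _ ≤ _ := by gcongr

/-! ### The core -/

theorem productSection_mem_Icc {F C : Type} [Fintype F] [Fintype C] {s : ClassicSpace F C}
    (hy : ∀ i, 0 ≤ s.1 i ∧ s.1 i ≤ 1) (hx : ∀ i j, 0 ≤ s.2 i j ∧ s.2 i j ≤ 1) :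
    productSection s ∈ Set.Icc 0 1 := by
  have h0 : ∀ E : Finset F, 0 ≤ ∏ i ∈ E, s.1 i := fun E => Finset.prod_nonneg fun i _ => (hy i).1
  have h1 : ∀ E : Finset F, ∏ i ∈ E, s.1 i ≤ 1 := fun E =>
    Finset.prod_le_one (fun i _ => (hy i).1) fun i _ => (hy i).2
  constructor <;> rintro (E | ⟨E, i, j⟩)
  · exact h0 E.1
  · exact mul_nonneg (h0 E) (hx i j).1
  · exact h1 E.1
  · exact mul_le_one₀ (h1 E) (hx i j).1 (hx i j).2

theorem productSection_mem_Icc_of_mem_feasible {F C : Type} [Fintype F] [Fintype C]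
    {I : CFLInstance F C} {s : ClassicSpace F C} (hs : s ∈ I.feasible) :
    productSection s ∈ Set.Icc 0 1 := by
  have hy : ∀ i, 0 ≤ s.1 i ∧ s.1 i ≤ 1 := fun i => by
    rcases hs.1 i with h | h <;> simp [h]
  exact productSection_mem_Icc hy fun i j => ⟨(hs.2.1 i j).1, (hs.2.1 i j).2.trans (hy i).2⟩

theorem coreVector_mem_Icc {n : ℕ} (hn : 21 ≤ n) {k l : Finset (Fin (3 * n))}
    (hk : k.card = n) (hl : l.card = n) (hkl : Disjoint k l) :
    coreVector k l ∈ Set.Icc 0 1 := by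
  have hp0 : 0 < caseTwoProb n := caseTwoProb_pos (by omega)
  have hp1 : caseTwoProb n < 1 := caseTwoProb_lt_one hn
  have h1n : (1 : ℝ) ≤ n := by exact_mod_cast (by omega : 1 ≤ n)
  have hT : (0 : ℝ) < (caseTwoSets k l).card := by
    exact_mod_cast (caseTwoSets_nonempty (by omega) hl hkl).card_pos
  set W : Set (ProductSpace (Fin (3 * n)) (Fin (n ^ 4 + 1))) := Set.Icc 0 1
  have hW : Convex ℝ W := convex_Icc 0 1
  have hone : productSection (caseOne k l) ∈ W := by
    refine productSection_mem_Icc (fun i => ?_) fun i j => ?_ <;> simp only [caseOne] <;> split_ifs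
    · norm_num
    · norm_num
    · exact ⟨by positivity, (div_le_one (by linarith)).mpr h1n⟩
    · norm_num
  have htwo : ∑ q ∈ caseTwoSets k l, ((caseTwoSets k l).card : ℝ)⁻¹ •
      productSection (caseTwo k l q) ∈ W := by
    refine hW.sum_mem (fun q _ => by positivity) ?_ fun q hq =>
      productSection_mem_Icc_of_mem_feasible (caseTwo_mem_feasible hn hk hl hq)
    rw [Finset.sum_const, nsmul_eq_mul, mul_inv_cancel₀ hT.ne']
  have hmem := hW hone htwo (by linarith : 0 ≤ 1 - caseTwoProb n) hp0.le (by ring)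
  rw [coreVector_eq_hybridMean]
  simpa only [hybridMean, Finset.smul_sum, smul_smul, ← div_eq_mul_inv] using hmem

theorem midpoint_coreVector_mem_canonical {n : ℕ} (hn : 21 ≤ n) {k l l' : Finset (Fin (3 * n))}
    (hk : k.card = n) (hl : l.card = n) (hl' : l'.card = n) (hkl : Disjoint k l)
    (hkl' : Disjoint k l') (hne : l ≠ l') :
    midpoint ℝ (coreVector k l) (coreVector k l') ∈ (hardInstance n).canonical := by
  rw [coreVector_eq_hybridMean, coreVector_eq_hybridMean]
  exact midpoint_mem_convexHull hn hk hl hl' hkl hkl' hne isMixedAffine_productSection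

/-- If two core vectors coincided, their midpoint would be a core vector in the canonical product
relaxation. -/
theorem coreVector_injOn {n : ℕ} (hn : 21 ≤ n) {k : Finset (Fin (3 * n))} (hk : k.card = n) :
    Set.InjOn (coreVector k) (Finset.powersetCard n kᶜ : Finset (Finset (Fin (3 * n)))) := by
  intro l hl l' hl' heq
  simp only [Finset.mem_coe, Finset.mem_powersetCard,
    Finset.subset_compl_iff_disjoint_left] at hl hl'
  by_contra hne
  have h := midpoint_coreVector_mem_canonical hn hk hl.2 hl'.2 hl.1 hl'.1 hne
  rw [← heq, midpoint_self] at h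
  exact coreVector_notMem_canonical hn hk hl.2 hl.1 h

theorem card_powersetCard_compl {n : ℕ} {k : Finset (Fin (3 * n))} (hk : k.card = n) :
    (Finset.powersetCard n kᶜ).card = (2 * n).choose n := by
  rw [Finset.card_powersetCard, Finset.card_compl, hk, Fintype.card_fin]
  congr 1
  omega

theorem core_eq_image {n : ℕ} (k : Finset (Fin (3 * n))) :
    core k = coreVector k '' (Finset.powersetCard n kᶜ : Finset (Finset (Fin (3 * n)))) := by
  ext z
  simp only [core, Set.mem_ofPred_eq, Set.mem_image, Finset.mem_coe, Finset.mem_powersetCard,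
    Finset.subset_compl_iff_disjoint_left]
  constructor
  · rintro ⟨l, hl, hkl, rfl⟩
    exact ⟨l, ⟨hkl, hl⟩, rfl⟩
  · rintro ⟨l, ⟨hkl, hl⟩, rfl⟩
    exact ⟨l, hl, hkl, rfl⟩

theorem core_finite {n : ℕ} (k : Finset (Fin (3 * n))) : (core k).Finite := by
  rw [core_eq_image]
  exact (Finset.finite_toSet _).image _

theorem ncard_core {n : ℕ} (hn : 21 ≤ n) {k : Finset (Fin (3 * n))} (hk : k.card = n) :
    (core k).ncard = (2 * n).choose n := by
  rw [core_eq_image, (coreVector_injOn hn hk).ncard_image, Set.ncard_coe_finset,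
    card_powersetCard_compl hk]

theorem core_subset {n : ℕ} (hn : 21 ≤ n) {k : Finset (Fin (3 * n))} (hk : k.card = n) :
    core k ⊆ Set.Icc 0 1 \ (hardInstance n).canonical := by
  rintro _ ⟨l, hl, hkl, rfl⟩
  exact ⟨coreVector_mem_Icc hn hk hl hkl, coreVector_notMem_canonical hn hk hl hkl⟩

theorem pair_mem_edgeSet {n : ℕ} (hn : 21 ≤ n) {k : Finset (Fin (3 * n))} (hk : k.card = n)
    {z z' : ProductSpace (Fin (3 * n)) (Fin (n ^ 4 + 1))} (hz : z ∈ core k) (hz' : z' ∈ core k)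
    (hne : z ≠ z') : {z, z'} ∈ ((hardInstance n).conflictHypergraph (core k)).edgeSet := by
  have hsub : {z, z'} ⊆ core k := Set.insert_subset hz (Set.singleton_subset_iff.mpr hz')
  refine ⟨hsub, hsub.trans (core_subset hn hk), midpoint ℝ z z', ?_, ?_⟩
  · rw [convexHull_pair]
    exact midpoint_mem_segment z z'
  · obtain ⟨l, hl, hkl, rfl⟩ := hz
    obtain ⟨l', hl', hkl', rfl⟩ := hz'
    exact midpoint_coreVector_mem_canonical hn hk hl hl' hkl hkl' fun h => hne (by rw [h])

/-! ### The chromatic number of a clique -/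

/-- Pairs being hyperedges forces a colouring to be injective; no hyperedge having fewer than two
vertices makes injective colourings admissible. -/
theorem hypergraphChromaticNumber_eq_ncard {α : Type} {H : Hypergraph α}
    (hfin : H.vertexSet.Finite)
    (hpair : ∀ v ∈ H.vertexSet, ∀ v' ∈ H.vertexSet, v ≠ v' → {v, v'} ∈ H.edgeSet)
    (hnontriv : ∀ e ∈ H.edgeSet, e.Nontrivial) :
    hypergraphChromaticNumber H = H.vertexSet.ncard := by
  have : Finite H.vertexSet := hfin
  refine le_antisymm ?_ (le_iInf₂ fun m hm => ?_)
  · refine iInf₂_le (H.vertexSet.ncard) ?_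
    refine ⟨Finite.equivFin H.vertexSet, fun e he a => ?_⟩
    obtain ⟨v, hv, v', hv', hne⟩ := hnontriv e he
    have hsub := H.subset_vertexSet_of_mem_edgeSet' he
    by_contra! hcon
    have h := (hcon ⟨v, hsub hv⟩ hv).trans (hcon ⟨v', hsub hv'⟩ hv').symm
    exact hne (congrArg Subtype.val ((Finite.equivFin H.vertexSet).injective h))
  · obtain ⟨col, hcol⟩ := hm
    have hinj : Function.Injective col := by
      intro v v' heq
      by_contra hne
      obtain ⟨u, hu, hua⟩ := hcol _ (hpair v v.2 v' v'.2 fun h => hne (Subtype.ext h)) (col v)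
      rcases hu with hu | hu
      · exact hua (congrArg col (Subtype.ext hu))
      · exact hua ((congrArg col (Subtype.ext hu)).trans heq.symm)
    have hle := Nat.card_le_card_of_injective col hinj
    rw [Nat.card_eq_fintype_card (α := Fin m), Fintype.card_fin] at hle
    exact_mod_cast hle

/-- A set of vectors outside the canonical product relaxation has to contain two of them to be
conflicting. -/
theorem nontrivial_of_conflicting {F C : Type} [Fintype F] [Fintype C] {I : CFLInstance F C}
    {e : Set (ProductSpace F C)} (he : I.Conflicting e) : e.Nontrivial := by
  obtain ⟨hsub, z, hz, hzI⟩ := he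
  rw [← Set.not_subsingleton_iff]
  intro hss
  rcases hss.eq_empty_or_singleton with rfl | ⟨v, rfl⟩
  · simp at hz
  · rw [convexHull_singleton, Set.mem_singleton_iff] at hz
    exact (hsub rfl).2 (hz ▸ hzI)

theorem chromaticNumber_core {n : ℕ} (hn : 21 ≤ n) {k : Finset (Fin (3 * n))} (hk : k.card = n) :
    hypergraphChromaticNumber ((hardInstance n).conflictHypergraph (core k)) =
      (2 * n).choose n := by
  rw [hypergraphChromaticNumber_eq_ncard (core_finite k)
    (fun z hz z' hz' hne => pair_mem_edgeSet hn hk hz hz' hne)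
    fun e he => nontrivial_of_conflicting he.2]
  exact congrArg _ (ncard_core hn hk)

theorem two_pow_le_choose {n : ℕ} (hn : 4 ≤ n) : 2 ^ n ≤ (2 * n).choose n := by
  have h1 := Nat.four_pow_lt_mul_centralBinom n hn
  rw [Nat.centralBinom_eq_two_mul_choose] at h1
  have h2 : n * (2 * n).choose n ≤ 2 ^ n * (2 * n).choose n :=
    Nat.mul_le_mul_right _ Nat.lt_two_pow_self.le
  have h3 : 4 ^ n = 2 ^ n * 2 ^ n := by rw [← mul_pow]; rfl
  exact Nat.le_of_mul_le_mul_left (h3 ▸ h1.le.trans h2) (by positivity)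

/-! ### Extended formulations with a mixed-linear section -/

/-- The left-hand side of an inequality of a linear system, as a linear map. -/
def CFL.LinearSystem.lhs {F C : Type} [Fintype F] [Fintype C] {r s : ℕ} (Q : LinearSystem F C r s)
    (t : Fin r) : ClassicSpace F C × (Fin s → ℝ) →ₗ[ℝ] ℝ where
  toFun v := ∑ i, Q.coeffY t i * v.1.1 i + ∑ i, ∑ j, Q.coeffX t i j * v.1.2 i j +
    ∑ e, Q.coeffU t e * v.2 e
  map_add' v v' := by
    simp only [Prod.fst_add, Prod.snd_add, Pi.add_apply, mul_add, Finset.sum_add_distrib]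
    ring
  map_smul' a v := by
    simp only [Prod.smul_fst, Prod.smul_snd, Pi.smul_apply, smul_eq_mul, mul_add, Finset.mul_sum,
      RingHom.id_apply, mul_left_comm a]

theorem isMixedAffine_section {F C : Type} {s : ℕ}
    (g : (F → ℝ) → ((F → C → ℝ) →ᵃ[ℝ] (Fin s → ℝ))) :
    IsMixedAffine (fun p : ClassicSpace F C => (p, g p.1 p.2)) := by
  intro y x x' a b hab
  refine Prod.ext (Prod.ext ?_ rfl) ?_
  · change y = a • y + b • y
    rw [← add_smul, hab, one_smul]
  · exact Convex.combo_affine_apply hab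

/-- The mean of the mixed section under `𝒟_{k,l}` violates an inequality of an approximate extended
formulation, because its classic part is too cheap for the objective function that separates
`z_{k,l}`. -/
theorem exists_rhs_lt_lhs {n r s : ℕ} (hn : 21 ≤ n) {k l : Finset (Fin (3 * n))}
    (hk : k.card = n) (hl : l.card = n) (hkl : Disjoint k l)
    {Q : LinearSystem (Fin (3 * n)) (Fin (n ^ 4 + 1)) r s}
    (hQ : Q.IsApproxEF (hardInstance n) (1 / 60 * ((3 * n : ℕ) : ℝ)))
    (g : ClassicSpace (Fin (3 * n)) (Fin (n ^ 4 + 1)) → Fin s → ℝ) :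
    ∃ t, Q.rhs t < Q.lhs t (hybridMean k l l fun p => (p, g p)) := by
  by_contra! hcon
  have h0 : (0 : ℝ) < n := by exact_mod_cast (by omega : 0 < n)
  have hproj : (hybridMean k l l fun p => (p, g p)).1 ∈ Q.proj := ⟨_, hcon⟩
  have hfst : (hybridMean k l l fun p => (p, g p)).1 = classicPart (coreVector k l) := by
    rw [classicPart_coreVector]
    exact map_hybridMean (LinearMap.fst ℝ (ClassicSpace (Fin (3 * n)) (Fin (n ^ 4 + 1)))
      (Fin s → ℝ)) k l l fun p => (p, g p)
  have hge := hQ.2 _ (separatingCost_mem_admissible k l) _ hproj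
  rw [hfst] at hge
  have hmin : 1 ≤ sInf (cost (separatingCost k l) '' (hardInstance n).polytope) := by
    have hne : (hardInstance n).polytope.Nonempty := (feasible_nonempty hn hk hl hkl).convexHull
    refine le_csInf (hne.image _) ?_
    rintro _ ⟨p, hp, rfl⟩
    refine le_apply_of_mem_convexHull_image (Φ := id)
      ((isLinearMap_cost (separatingCost k l)).mk' _)
      (fun p hp => one_le_cost_of_mem_feasible hn hk hkl hp) ?_
    rwa [Set.image_id]
  have hρ : (20 : ℝ) / n ≤ (1 / 60 * ((3 * n : ℕ) : ℝ))⁻¹ *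
      sInf (cost (separatingCost k l) '' (hardInstance n).polytope) := by
    calc (20 : ℝ) / n = (1 / 60 * ((3 * n : ℕ) : ℝ))⁻¹ * 1 := by
          push_cast
          field_simp
          norm_num
      _ ≤ _ := by gcongr
  exact (hρ.trans hge).not_gt (cost_classicPart_coreVector_lt hn hl hkl)

/-- Distinct sets `l` violate distinct inequalities: an inequality violated by two means would be
violated by their midpoint, which is a convex combination of points of the section. -/
theorem choose_le_size {n r s : ℕ} (hn : 21 ≤ n)
    {Q : LinearSystem (Fin (3 * n)) (Fin (n ^ 4 + 1)) r s}
    (hQ : Q.IsApproxEF (hardInstance n) (1 / 60 * ((3 * n : ℕ) : ℝ)))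
    (hsec : Q.HasMixedLinearSection (hardInstance n)) : (2 * n).choose n ≤ r := by
  obtain ⟨g, hg⟩ := hsec
  obtain ⟨k, hk⟩ : ∃ k : Finset (Fin (3 * n)), k.card = n := by
    obtain ⟨k, -, hk⟩ := Finset.exists_subset_card_eq
      (s := (Finset.univ : Finset (Fin (3 * n)))) (n := n) (by simp; omega)
    exact ⟨k, hk⟩
  have hviol : ∀ l : (Finset.powersetCard n kᶜ : Finset (Finset (Fin (3 * n)))), ∃ t,
      Q.rhs t < Q.lhs t (hybridMean k l.1 l.1 fun p => (p, g p.1 p.2)) := by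
    rintro ⟨l, hl⟩
    rw [Finset.mem_powersetCard, Finset.subset_compl_iff_disjoint_left] at hl
    exact exists_rhs_lt_lhs hn hk hl.2 hl.1 hQ fun p => g p.1 p.2
  choose t ht using hviol
  have hinj : Function.Injective t := by
    rintro ⟨l, hl⟩ ⟨l', hl'⟩ heq
    have h1 := ht ⟨l, hl⟩
    have h2 := ht ⟨l', hl'⟩
    rw [← heq] at h2
    generalize t ⟨l, hl⟩ = t₀ at h1 h2
    rw [Finset.mem_powersetCard, Finset.subset_compl_iff_disjoint_left] at hl hl'
    by_contra hne
    have hmid := midpoint_mem_convexHull hn hk hl.2 hl'.2 hl.1 hl'.1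
      (fun h => hne (Subtype.ext h)) (isMixedAffine_section g)
    have hle := le_apply_of_mem_convexHull_image (-(Q.lhs t₀))
      (a := -Q.rhs t₀) (fun p hp => neg_le_neg (hg p hp t₀)) hmid
    rw [midpoint_eq_smul_add, map_smul, map_add, LinearMap.neg_apply, LinearMap.neg_apply,
      smul_eq_mul, invOf_eq_inv] at hle
    dsimp only at h1 h2
    linarith
  have hcard := Fintype.card_le_of_injective t hinj
  rwa [Fintype.card_coe, card_powersetCard_compl hk, Fintype.card_fin] at hcard

theorem theorem5 :
    ∃ c₁ : ℝ, 0 < c₁ ∧ ∃ c₂ : ℝ, 0 < c₂ ∧ ∃ c : ℝ, 0 < c ∧ ∃ c₃ : ℝ, 0 < c₃ ∧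
      ∃ n₀ : ℕ, ∀ n : ℕ, n₀ ≤ n →
        -- the core, for any fixed set `k` of `n` facilities
        (∀ k : Finset (Fin (3 * n)), k.card = n →
          CFL.core k ⊆ Set.Icc 0 1 \ (CFL.hardInstance n).canonical ∧
          (∀ z ∈ CFL.core k, (CFL.hardInstance n).GapInducing (c₁ * n) z) ∧
          (CFL.core k).ncard = (2 * n).choose n ∧
          (∀ z ∈ CFL.core k, ∀ z' ∈ CFL.core k, z ≠ z' →
            {z, z'} ∈ ((CFL.hardInstance n).conflictHypergraph (CFL.core k)).edgeSet) ∧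
          CFL.hypergraphChromaticNumber
            ((CFL.hardInstance n).conflictHypergraph (CFL.core k)) = (2 * n).choose n ∧
          (2 : ℝ) ^ (c₂ * n) ≤
            ((CFL.hypergraphChromaticNumber
              ((CFL.hardInstance n).conflictHypergraph (CFL.core k))).toNat : ℝ)) ∧
        -- the lower bound on the size, with `N = 3 * n` facilities
        (∀ (r s : ℕ) (Q : CFL.LinearSystem (Fin (3 * n)) (Fin (n ^ 4 + 1)) r s),
          Q.IsApproxEF (CFL.hardInstance n) (c * ((3 * n : ℕ) : ℝ)) →
          Q.HasMixedLinearSection (CFL.hardInstance n) →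
          (2 : ℝ) ^ (c₃ * ((3 * n : ℕ) : ℝ)) ≤ (r : ℝ)) := by
  refine ⟨1 / 20, by norm_num, 1, one_pos, 1 / 60, by norm_num, 1 / 3, by norm_num, 21,
    fun n hn => ⟨fun k hk => ⟨core_subset hn hk, ?_, ncard_core hn hk,
      fun z hz z' hz' hne => pair_mem_edgeSet hn hk hz hz' hne, chromaticNumber_core hn hk, ?_⟩,
      fun r s Q hQ hsec => ?_⟩⟩
  · rintro _ ⟨l, hl, hkl, rfl⟩
    exact coreVector_gapInducing hn hk hl hkl
  · rw [chromaticNumber_core hn hk, ENat.toNat_natCast, one_mul, Real.rpow_natCast]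
    exact_mod_cast two_pow_le_choose (by omega)
  · have hexp : (1 / 3 : ℝ) * ((3 * n : ℕ) : ℝ) = n := by
      push_cast
      ring
    rw [hexp, Real.rpow_natCast]
    exact_mod_cast (two_pow_le_choose (by omega)).trans (choose_le_size hn hQ hsec)
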